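/- Let $\mathbb H=\{z\in\mathbb C:\operatorname{Im} z>0\}$ and, for $z\in\mathbb C\setminus(-\infty,0]$, let $$\log\Gamma(z)=-\log z-\gamma z-\sum_{n=1}^{\infty}\Big(\log\big(1+\tfrac zn\big)-\tfrac zn\Big),$$ where $\log$ on the right-hand side is the principal logarithm and $\gamma$ is Euler's constant; the series converges absolutely for each such $z$. There are a unique minimum point $x_0$ of $\Gamma$ on $(0,\infty)$ and, for each integer $k\ge1$, a unique minimum point $x_k$ of $|\Gamma|$ on $(-k,1-k)$. The function $\log\Gamma$ maps $\mathbb H$ conformally (that is, it is holomorphic and injective on $\mathbb H$, with non-vanishing derivative) onto $$\mathcal V=\mathbb C\setminus\bigcup_{k=0}^{\infty}\{t-ik\pi : t\ge \log|\Gamma(x_k)|\}.$$ For every $k\in\mathbb Z$ and $z\in\mathbb H$ the point $\log z-i(k+1)\pi$ (principal logarithm) lies in $\mathcal V$. Let $(\log\Gamma)^{-1}:\mathcal V\to\mathbb H$ be the inverse of $\log\Gamma|_{\mathbb H}$ and $$g_k(z)=(\log\Gamma)^{-1}\big(\log z-i(k+1)\pi\big),\qquad z\in\mathbb H .$$ Then,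 for every $k\in\mathbb Z$, $g_k$ maps $\mathbb H$ into $\mathbb H$ and is a Nevanlinna–Pick function (that is, it is holomorphic on $\mathbb H$ with values in the closed upper half-plane), and $\Gamma(g_k(z))=(-1)^{k+1}z$ for all $z\in\mathbb H$. -/

import Mathlib

open UpperHalfPlane (upperHalfPlaneSet)

/-- The `n`-th term, with `n + 1` in place of the summation index starting at `1`, of the series
defining `log Γ`. -/
noncomputable def logGammaTerm (z : ℂ) (n : ℕ) : ℂ :=
  Complex.log (1 + z / ((n : ℂ) + 1)) - z / ((n : ℂ) + 1)

/-- The holomorphic branch of the logarithm of the Gamma function on `ℂ \ (-∞, 0]`: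
`log Γ(z) = -log z - γ z - ∑_{n ≥ 1} (log (1 + z / n) - z / n)`, with principal logarithms. -/
noncomputable def logGamma (z : ℂ) : ℂ :=
  -Complex.log z - (Real.eulerMascheroniConstant : ℂ) * z - ∑' n : ℕ, logGammaTerm z n

/-- `x 0` is a minimum point of `Γ` on `(0, ∞)` and, for `k ≥ 1`, `x k` is a minimum point of `|Γ|`
on `(-k, 1 - k)`. -/
def IsGammaMinPoints (x : ℕ → ℝ) : Prop :=
  (x 0 ∈ Set.Ioi (0 : ℝ) ∧ IsMinOn Real.Gamma (Set.Ioi 0) (x 0)) ∧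
  ∀ k : ℕ, 1 ≤ k →
    x k ∈ Set.Ioo (-(k : ℝ)) (1 - (k : ℝ)) ∧
    IsMinOn (fun t => |Real.Gamma t|) (Set.Ioo (-(k : ℝ)) (1 - (k : ℝ))) (x k)

/-- The plane without the horizontal slits `[log |Γ(x k)|, ∞) × {-k π}`, `k ≥ 0`. -/
def slitDomain (x : ℕ → ℝ) : Set ℂ :=
  (⋃ k : ℕ, Set.Ici (Real.log |Real.Gamma (x k)|) ×ℂ {-((k : ℝ) * Real.pi)})ᶜ

/-- `f` is a conformal mapping of the open set `U` onto its image: holomorphic, injective and with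
nowhere vanishing derivative. -/
def IsConformalMapping (f : ℂ → ℂ) (U : Set ℂ) : Prop :=
  DifferentiableOn ℂ f U ∧ Set.InjOn f U ∧ ∀ z ∈ U, deriv f z ≠ 0

/-- Nevanlinna-Pick functions: holomorphic on the open upper half-plane, with values in the closed
upper half-plane. -/
def IsNevanlinnaPick (f : ℂ → ℂ) : Prop :=
  DifferentiableOn ℂ f upperHalfPlaneSet ∧
  Set.MapsTo f upperHalfPlaneSet (closure upperHalfPlaneSet)

/-- The argument `log z - i (k + 1) π` at which the inverse of `log Γ` is evaluated. -/
noncomputable def shiftedLog (k : ℤ) (z : ℂ) : ℂ :=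
  Complex.log z - Complex.I * ((k : ℂ) + 1) * (Real.pi : ℂ)

/-- `g_k(z) = (log Γ)⁻¹ (log z - i (k + 1) π)`, where `(log Γ)⁻¹` is the inverse of the restriction
of `log Γ` to the open upper half-plane. -/
noncomputable def gammaInverse (k : ℤ) (z : ℂ) : ℂ :=
  Function.invFunOn logGamma upperHalfPlaneSet (shiftedLog k z)

open Filter Topology

/-! The derivative of `logGamma` is the digamma series, whose imaginary part on the upper half-plane
is `∑ y / |z + n|²` over `n ≥ 0`, hence positive. On a convex domain this makes `logGamma` injective
(`injOn_logGamma`), and it makes the derivative nonzero, so the image is open.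

On the `k`-th real interval between poles, `logGamma` takes from above the boundary values `log |Γ
p| - i k π` (`logGamma_ofReal`, `tendsto_logGamma_ofReal`). Since `|Γ|` tends to infinity at the
left end, these values fill the `k`-th slit. The image misses them: a continuous inverse near such a
value would send it both to an interior point and to a real one.

Conversely, the image is relatively closed in the slit domain. Sublevel sets of `‖logGamma‖` are
bounded (`isBounded_norm_logGamma_le`), so a limit of image points comes from a convergent sequence
of preimages. Its limit is an interior point, a real point giving a slit value, or a pole, which `1
/ Γ` excludes. Since the slit domain is connected, it equals the image.

Finally, `arg z` lies strictly between `0` and `π`, so `shiftedLog` never meets the height of a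
slit; exponentiating `logGamma (g_k z) = shiftedLog k z` gives the functional identity. -/

/-! ### Convergence of the series, its exponential and its functional equation -/

theorem summable_logGammaTerm (z : ℂ) : Summable (logGammaTerm z) := by
  have hs : Summable fun n : ℕ => ‖z‖ ^ 2 * (1 / ((n : ℝ) + 1) ^ 2) := by
    have := (summable_nat_add_iff 1).2 (Real.summable_one_div_nat_pow.2 (le_refl 2))
    exact (by simpa using this : Summable fun n : ℕ => 1 / ((n : ℝ) + 1) ^ 2).mul_left _
  refine Summable.of_norm_bounded_eventually_nat hs ?_
  filter_upwards [tendsto_natCast_atTop_atTop.eventually_ge_atTop (2 * ‖z‖)] with n hn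
  have hn1 : (0 : ℝ) < (n : ℝ) + 1 := by positivity
  have hnorm : ‖z / ((n : ℂ) + 1)‖ = ‖z‖ / ((n : ℝ) + 1) := by
    rw [norm_div]
    congr 1
    exact_mod_cast Complex.norm_natCast (n + 1)
  have hle : ‖z / ((n : ℂ) + 1)‖ ≤ 1 / 2 := by
    rw [hnorm, div_le_iff₀ hn1]
    linarith
  have h := Complex.norm_log_one_add_sub_self_le (z := z / ((n : ℂ) + 1)) (by linarith)
  have hinv : (1 - ‖z / ((n : ℂ) + 1)‖)⁻¹ ≤ 2 := by
    rw [inv_le_comm₀ (by linarith) two_pos]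
    linarith
  calc ‖logGammaTerm z n‖ ≤ ‖z / ((n : ℂ) + 1)‖ ^ 2 * (1 - ‖z / ((n : ℂ) + 1)‖)⁻¹ / 2 := h
    _ ≤ ‖z / ((n : ℂ) + 1)‖ ^ 2 * 2 / 2 := by gcongr
    _ = ‖z‖ ^ 2 * (1 / ((n : ℝ) + 1) ^ 2) := by rw [hnorm]; field_simp

/-- Partial sums of the series for `logGamma`. -/
noncomputable def logGammaPartial (z : ℂ) (N : ℕ) : ℂ :=
  -Complex.log z - (Real.eulerMascheroniConstant : ℂ) * z
    - ∑ n ∈ Finset.range N, logGammaTerm z n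

theorem tendsto_logGammaPartial (z : ℂ) :
    Tendsto (logGammaPartial z) atTop (𝓝 (logGamma z)) :=
  ((summable_logGammaTerm z).hasSum.tendsto_sum_nat).const_sub _

theorem logGammaTerm_eq {z : ℂ} (n : ℕ) (hz : z + (n + 1) ≠ 0) :
    logGammaTerm z n =
      Complex.log (z + (n + 1)) - (Real.log (n + 1) : ℝ) - z * ((1 / ((n : ℝ) + 1) : ℝ) : ℂ) := by
  have h1 : (0 : ℝ) < (n : ℝ) + 1 := by positivity
  have h2 : (n : ℂ) + 1 ≠ 0 := by exact_mod_cast h1.ne'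
  have h3 : z + (n + 1) = ((n + 1 : ℝ) : ℂ) * (1 + z / ((n : ℂ) + 1)) := by
    push_cast
    field_simp
    ring
  have h4 : 1 + z / ((n : ℂ) + 1) ≠ 0 := fun h => hz (by rw [h3, h, mul_zero])
  rw [h3, Complex.log_ofReal_mul h1 h4, logGammaTerm]
  push_cast
  ring

/-- This is the logarithm of Gauss's product. Only positive reals are factored out of the
logarithms, so no branch correction arises, even on the negative axis. -/
theorem logGammaPartial_eq {z : ℂ} (hz : ∀ j : ℕ, z + j ≠ 0) (N : ℕ) :
    logGammaPartial z N = -∑ j ∈ Finset.range (N + 1), Complex.log (z + j)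
      + (Real.log (N.factorial) : ℝ)
      + z * ((harmonic N : ℝ) - Real.eulerMascheroniConstant : ℝ) := by
  induction N with
  | zero => simp [logGammaPartial]; ring
  | succ N ih =>
    have h0 : z + ((N : ℂ) + 1) ≠ 0 := by exact_mod_cast hz (N + 1)
    have h1 : logGammaPartial z (N + 1) = logGammaPartial z N - logGammaTerm z N := by
      simp only [logGammaPartial, Finset.sum_range_succ]
      ring
    have h2 : Real.log ((N + 1).factorial) = Real.log (N + 1) + Real.log N.factorial := by
      rw [Nat.factorial_succ]
      push_cast
      exact Real.log_mul (by positivity) (by positivity)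
    rw [h1, ih, logGammaTerm_eq N h0, Finset.sum_range_succ _ (N + 1), h2, harmonic_succ]
    generalize Real.log (N.factorial) = a
    generalize Real.log ((N : ℝ) + 1) = b
    push_cast
    ring

theorem exp_logGamma {z : ℂ} (hz : ∀ j : ℕ, z + j ≠ 0) :
    Complex.exp (logGamma z) = Complex.Gamma z := by
  have h1 : Tendsto (fun N => Complex.exp (logGammaPartial z N)) atTop
      (𝓝 (Complex.exp (logGamma z))) :=
    (Complex.continuous_exp.tendsto _).comp (tendsto_logGammaPartial z)
  have h2 : Tendsto (fun N : ℕ => ((harmonic N : ℝ) - Real.log N - Real.eulerMascheroniConstant : ℝ))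
      atTop (𝓝 0) := by
    simpa using Real.tendsto_harmonic_sub_log.sub_const Real.eulerMascheroniConstant
  have h3 : Tendsto (fun N : ℕ => Complex.GammaSeq z N * Complex.exp
      (z * ((harmonic N : ℝ) - Real.log N - Real.eulerMascheroniConstant : ℝ))) atTop
      (𝓝 (Complex.Gamma z)) := by
    have h4 := ((Complex.continuous_ofReal.tendsto 0).comp h2).const_mul z
    have h5 := (Complex.continuous_exp.tendsto _).comp h4
    simpa using (Complex.GammaSeq_tendsto_Gamma z).mul h5
  refine tendsto_nhds_unique (h1.congr' ?_) h3
  filter_upwards [eventually_ge_atTop 1] with N hN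
  have hN0 : (0 : ℝ) < N := by exact_mod_cast hN
  have hprod : Complex.exp (∑ j ∈ Finset.range (N + 1), Complex.log (z + j))
      = ∏ j ∈ Finset.range (N + 1), (z + j) := by
    rw [Complex.exp_sum]
    exact Finset.prod_congr rfl fun j _ => Complex.exp_log (hz j)
  have hfac : Complex.exp (Real.log (N.factorial) : ℝ) = (N.factorial : ℂ) := by
    rw [← Complex.ofReal_exp, Real.exp_log (by positivity), Complex.ofReal_natCast]
  rw [logGammaPartial_eq hz, Complex.exp_add, Complex.exp_add, Complex.exp_neg, hprod, hfac,
    Complex.GammaSeq, Complex.cpow_def_of_ne_zero (by exact_mod_cast hN0.ne'),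
    ← Complex.natCast_log]
  have : Complex.exp (z * ((harmonic N : ℝ) - Real.eulerMascheroniConstant : ℝ)) =
      Complex.exp ((Real.log N : ℝ) * z) *
        Complex.exp (z * ((harmonic N : ℝ) - Real.log N - Real.eulerMascheroniConstant : ℝ)) := by
    rw [← Complex.exp_add]
    congr 1
    push_cast
    ring
  rw [this]
  ring

theorem logGamma_add_one {z : ℂ} (hz : ∀ j : ℕ, z + j ≠ 0) :
    logGamma (z + 1) = logGamma z + Complex.log z := by
  have hz1 : ∀ j : ℕ, z + 1 + j ≠ 0 := fun j => by
    have := hz (j + 1)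
    push_cast at this
    rwa [add_assoc, add_comm (1 : ℂ)]
  -- The two sums of logarithms telescope; only the first and last terms survive.
  have key : ∀ᶠ N : ℕ in atTop, logGammaPartial (z + 1) N - logGammaPartial z N =
      Complex.log z - Complex.log (1 + (z + 1) / N)
        + ((harmonic N : ℝ) - Real.log N - Real.eulerMascheroniConstant : ℝ) := by
    filter_upwards [eventually_ge_atTop 1] with N hN
    have hN0 : (0 : ℝ) < N := by exact_mod_cast hN
    have hN1 : (N : ℂ) ≠ 0 := by exact_mod_cast hN0.ne'
    have h3 : z + 1 + N = ((N : ℝ) : ℂ) * (1 + (z + 1) / (N : ℂ)) := by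
      push_cast
      field_simp
      ring
    have h4 : 1 + (z + 1) / (N : ℂ) ≠ 0 := fun h => hz1 N (by rw [h3, h, mul_zero])
    rw [logGammaPartial_eq hz, logGammaPartial_eq hz1, Finset.sum_range_succ,
      Finset.sum_range_succ' (fun j : ℕ => Complex.log (z + j)), h3, Complex.log_ofReal_mul hN0 h4]
    have : ∀ j : ℕ, z + 1 + (j : ℂ) = z + ((j + 1 : ℕ) : ℂ) := fun j => by push_cast; ring
    simp only [this, Nat.cast_zero, add_zero]
    push_cast
    ring
  have h2 : Tendsto (fun N : ℕ =>
      (((harmonic N : ℝ) - Real.log N - Real.eulerMascheroniConstant : ℝ) : ℂ)) atTop (𝓝 0) := by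
    have : Tendsto (fun N : ℕ => ((harmonic N : ℝ) - Real.log N - Real.eulerMascheroniConstant : ℝ))
        atTop (𝓝 0) := by
      simpa using Real.tendsto_harmonic_sub_log.sub_const Real.eulerMascheroniConstant
    exact (Complex.continuous_ofReal.tendsto 0).comp this
  have h3 : Tendsto (fun N : ℕ => Complex.log (1 + (z + 1) / N)) atTop (𝓝 0) := by
    have h5 : Tendsto (fun N : ℕ => 1 + (z + 1) / (N : ℂ)) atTop (𝓝 1) := by
      simpa using (tendsto_const_div_atTop_nhds_zero_nat (z + 1)).const_add 1
    have h6 := (continuousAt_clog (x := 1) (by simp)).tendsto.comp h5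
    simpa [Function.comp_def] using h6
  have h4 := (h3.const_sub (Complex.log z)).add h2
  have h5 := (tendsto_logGammaPartial (z + 1)).sub (tendsto_logGammaPartial z)
  have := tendsto_nhds_unique (h5.congr' key) h4
  linear_combination this

theorem logGamma_add_nat {z : ℂ} (hz : ∀ j : ℕ, z + j ≠ 0) (m : ℕ) :
    logGamma (z + m) = logGamma z + ∑ j ∈ Finset.range m, Complex.log (z + j) := by
  induction m with
  | zero => simp
  | succ m ih =>
    have h : ∀ j : ℕ, z + m + j ≠ 0 := fun j => by simpa [add_assoc] using hz (m + j)
    rw [Finset.sum_range_succ, ← add_assoc, ← ih, ← logGamma_add_one h]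
    push_cast
    ring_nf

/-! ### The derivative of log Γ -/

/-- The derivative of `logGamma`, as a series. -/
noncomputable def digammaSeries (z : ℂ) : ℂ :=
  -z⁻¹ - (Real.eulerMascheroniConstant : ℂ)
    - ∑' n : ℕ, ((z + (n + 1))⁻¹ - ((n : ℂ) + 1)⁻¹)

theorem mem_slitPlane_add_nat {z : ℂ} (hz : z ∈ Complex.slitPlane) (n : ℕ) :
    z + n ∈ Complex.slitPlane := by
  rw [Complex.mem_slitPlane_iff] at *
  rcases hz with h | h
  · left
    simp only [Complex.add_re, Complex.natCast_re]
    positivity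
  · right
    simpa using h

theorem add_nat_ne_zero {z : ℂ} (hz : z ∈ Complex.slitPlane) (n : ℕ) : z + n ≠ 0 :=
  Complex.slitPlane_ne_zero (mem_slitPlane_add_nat hz n)

theorem hasDerivAt_logGammaTerm {z : ℂ} (hz : z ∈ Complex.slitPlane) (n : ℕ) :
    HasDerivAt (fun w => logGammaTerm w n) ((z + (n + 1))⁻¹ - ((n : ℂ) + 1)⁻¹) z := by
  have h2 : (n : ℂ) + 1 ≠ 0 := by exact_mod_cast n.succ_ne_zero
  have h0 : z + (n + 1) ≠ 0 := by exact_mod_cast add_nat_ne_zero hz (n + 1)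
  have h3 : 1 + z / ((n : ℂ) + 1) ∈ Complex.slitPlane := by
    have h4 := mem_slitPlane_add_nat hz (n + 1)
    have h5 : 1 + z / ((n : ℂ) + 1) = (((n + 1 : ℝ)⁻¹ : ℝ) : ℂ) * (z + ((n + 1 : ℕ) : ℂ)) := by
      push_cast
      field_simp
      ring
    rw [Complex.mem_slitPlane_iff] at h4 ⊢
    rw [h5, Complex.re_ofReal_mul, Complex.im_ofReal_mul]
    have h6 : (0 : ℝ) < (n + 1 : ℝ)⁻¹ := by positivity
    exact h4.imp (fun h => mul_pos h6 h) (fun h => mul_ne_zero h6.ne' h)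
  have hd : HasDerivAt (fun w : ℂ => w / ((n : ℂ) + 1)) (1 / ((n : ℂ) + 1)) z :=
    (hasDerivAt_id z).div_const _
  have h := ((hd.const_add 1).clog h3).sub hd
  refine h.congr_deriv ?_
  have h7 : 1 + z / ((n : ℂ) + 1) ≠ 0 := Complex.slitPlane_ne_zero h3
  have h8 : 1 + z / ((n : ℂ) + 1) = (z + (n + 1)) / (n + 1) := by
    field_simp
    ring
  rw [h8]
  field_simp

theorem summable_const_div_sq (C : ℝ) : Summable fun n : ℕ => C / ((n : ℝ) + 1) ^ 2 := by
  have := (summable_nat_add_iff 1).2 (Real.summable_one_div_nat_pow.2 (le_refl 2))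
  simpa [div_eq_mul_inv] using
    (by simpa using this : Summable fun n : ℕ => (((n : ℝ) + 1) ^ 2)⁻¹).mul_left C

theorem exists_norm_digammaSeries_term_le {z₀ : ℂ} (hz₀ : z₀ ∈ Complex.slitPlane) :
    ∃ r > 0, Metric.ball z₀ r ⊆ Complex.slitPlane ∧ ∃ C : ℝ, ∀ n : ℕ, ∀ z ∈ Metric.ball z₀ r,
      ‖(z + (n + 1))⁻¹ - ((n : ℂ) + 1)⁻¹‖ ≤ C / ((n : ℝ) + 1) ^ 2 := by
  obtain ⟨ε, hε, hball⟩ := Metric.isOpen_iff.1 Complex.isOpen_slitPlane z₀ hz₀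
  set r := ε / 2 with hr
  have hr0 : 0 < r := by positivity
  have hsub : Metric.ball z₀ r ⊆ Complex.slitPlane :=
    (Metric.ball_subset_ball (by linarith)).trans hball
  set R := ‖z₀‖ + r with hR
  have hR0 : 0 < R := by positivity
  -- The bound `‖z + (n + 1)‖ ≥ c (n + 1)` comes from the size of `n + 1` when `n + 1 ≥ 2 * R`, and
  -- otherwise from the distance `r` to the poles.
  set c := min (1 / 2) (r / (2 * R)) with hc
  have hc0 : 0 < c := by positivity
  refine ⟨r, hr0, hsub, R / c, fun n z hz => ?_⟩
  have hn : (0 : ℝ) < (n : ℝ) + 1 := by positivity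
  have hn' : ‖(n : ℂ) + 1‖ = (n : ℝ) + 1 := by exact_mod_cast Complex.norm_natCast (n + 1)
  have hzR : ‖z‖ ≤ R := by
    have h1 : ‖z - z₀‖ < r := by simpa [dist_eq_norm] using hz
    have h2 := norm_le_norm_add_norm_sub' z z₀
    linarith
  have h1 : r ≤ ‖z + (n + 1)‖ := by
    by_contra! h
    have h3 : -((n : ℂ) + 1) ∈ Metric.ball z₀ ε := by
      have h1 : ‖z - z₀‖ < r := by simpa [dist_eq_norm] using hz
      have h4 : -((n : ℂ) + 1) - z₀ = (z - z₀) - (z + (n + 1)) := by ring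
      rw [Metric.mem_ball, dist_eq_norm, h4]
      have := norm_sub_le (z - z₀) (z + (n + 1))
      linarith
    have h5 := hball h3
    have h6 : -((n : ℂ) + 1) = ((-((n : ℝ) + 1) : ℝ) : ℂ) := by push_cast; ring
    rw [h6, Complex.ofReal_mem_slitPlane] at h5
    linarith
  have h2 : (n : ℝ) + 1 - R ≤ ‖z + (n + 1)‖ := by
    have := norm_sub_le_norm_add ((n : ℂ) + 1) z
    rw [hn', add_comm ((n : ℂ) + 1)] at this
    linarith
  have h3 : c * ((n : ℝ) + 1) ≤ ‖z + (n + 1)‖ := by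
    rcases le_total (2 * R) ((n : ℝ) + 1) with h | h
    · have : c * ((n : ℝ) + 1) ≤ 1 / 2 * ((n : ℝ) + 1) := by gcongr; exact min_le_left _ _
      linarith
    · calc c * ((n : ℝ) + 1) ≤ r / (2 * R) * (2 * R) := by gcongr; exact min_le_right _ _
        _ = r := by field_simp
        _ ≤ _ := h1
  have h4 : z + (n + 1) ≠ 0 := by exact_mod_cast add_nat_ne_zero (hsub hz) (n + 1)
  have h5 : (n : ℂ) + 1 ≠ 0 := by exact_mod_cast n.succ_ne_zero
  have h6 : (z + (n + 1))⁻¹ - ((n : ℂ) + 1)⁻¹ = -z / ((z + (n + 1)) * (n + 1)) := by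
    field_simp
    ring
  rw [h6, norm_div, norm_mul, norm_neg, hn']
  calc ‖z‖ / (‖z + (n + 1)‖ * ((n : ℝ) + 1)) ≤ R / (c * ((n : ℝ) + 1) * ((n : ℝ) + 1)) := by gcongr
    _ = R / c / ((n : ℝ) + 1) ^ 2 := by field_simp

theorem summable_digammaSeries {z : ℂ} (hz : z ∈ Complex.slitPlane) :
    Summable fun n : ℕ => (z + (n + 1))⁻¹ - ((n : ℂ) + 1)⁻¹ := by
  obtain ⟨r, hr, -, C, h⟩ := exists_norm_digammaSeries_term_le hz
  exact Summable.of_norm_bounded (summable_const_div_sq C) fun n => h n z (Metric.mem_ball_self hr)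

theorem hasDerivAt_logGamma {z : ℂ} (hz : z ∈ Complex.slitPlane) :
    HasDerivAt logGamma (digammaSeries z) z := by
  obtain ⟨r, hr, hsub, C, h⟩ := exists_norm_digammaSeries_term_le hz
  have hs := hasDerivAt_tsum_of_isPreconnected (summable_const_div_sq C) Metric.isOpen_ball
    (convex_ball z r).isPreconnected (fun n y hy => hasDerivAt_logGammaTerm (hsub hy) n) h
    (Metric.mem_ball_self hr) (summable_logGammaTerm z) (Metric.mem_ball_self hr)
  have hl := (Complex.hasDerivAt_log hz).neg
  have hg := (hasDerivAt_id z).const_mul (Real.eulerMascheroniConstant : ℂ)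
  refine ((hl.sub hg).sub hs).congr_deriv ?_
  simp [digammaSeries]

/-! ### Mean value estimates on convex sets -/

/-- The real mean value theorem on the segment from `z` to `w`. The choice `a = -I` turns real parts
into imaginary parts. -/
theorem exists_re_mul_slope_eq {f f' : ℂ → ℂ} {s : Set ℂ} (hs : Convex ℝ s)
    (hf : ∀ z ∈ s, HasDerivAt f (f' z) z) {z w : ℂ} (hz : z ∈ s) (hw : w ∈ s) (hne : z ≠ w)
    (a : ℂ) : ∃ ξ ∈ s, (a * ((f w - f z) / (w - z))).re = (a * f' ξ).re := by
  have hd : w - z ≠ 0 := sub_ne_zero.2 hne.symm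
  have hmem : ∀ t ∈ Set.Icc (0 : ℝ) 1, z + t * (w - z) ∈ s := fun t ht => by
    have := hs.add_smul_sub_mem hz hw ht
    simpa using this
  have hder : ∀ t ∈ Set.Icc (0 : ℝ) 1,
      HasDerivAt (fun t : ℝ => (a * (f (z + t * (w - z)) / (w - z))).re)
        (a * f' (z + t * (w - z))).re t := fun t ht => by
    have h1 : HasDerivAt (fun u : ℂ => z + u * (w - z)) (w - z) (t : ℂ) := by
      simpa using ((hasDerivAt_id (t : ℂ)).mul_const (w - z)).const_add z
    have h2 := (((hf _ (hmem t ht)).comp (t : ℂ) h1).div_const (w - z)).const_mul a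
    refine h2.real_of_complex.congr_deriv ?_
    rw [mul_div_assoc, div_self hd, mul_one]
  obtain ⟨t, ht, h⟩ := exists_hasDerivAt_eq_slope _ _ (zero_lt_one' ℝ)
    (fun t ht => (hder t ht).continuousAt.continuousWithinAt)
    (fun t ht => hder t (Set.Ioo_subset_Icc_self ht))
  refine ⟨_, hmem t (Set.Ioo_subset_Icc_self ht), ?_⟩
  rw [h]
  simp only [Complex.ofReal_one, Complex.ofReal_zero, one_mul, zero_mul, add_zero, sub_zero,
    div_one, add_sub_cancel, ← Complex.sub_re]
  ring_nf

theorem mul_norm_sub_le_of_le_re_mul {f f' : ℂ → ℂ} {s : Set ℂ} (hs : Convex ℝ s)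
    (hf : ∀ z ∈ s, HasDerivAt f (f' z) z) {a : ℂ} (ha : ‖a‖ = 1) {c : ℝ}
    (hc : ∀ z ∈ s, c ≤ (a * f' z).re) {z w : ℂ} (hz : z ∈ s) (hw : w ∈ s) :
    c * ‖w - z‖ ≤ ‖f w - f z‖ := by
  rcases eq_or_ne z w with rfl | hne
  · simp
  obtain ⟨ξ, hξ, h⟩ := exists_re_mul_slope_eq hs hf hz hw hne a
  have hd : 0 < ‖w - z‖ := norm_pos_iff.2 (sub_ne_zero.2 hne.symm)
  have h1 : c ≤ ‖a * ((f w - f z) / (w - z))‖ :=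
    (hc ξ hξ).trans (h ▸ Complex.re_le_norm _)
  rwa [norm_mul, ha, one_mul, norm_div, le_div_iff₀ hd] at h1

theorem isBounded_norm_le_of_le_re_mul {f f' : ℂ → ℂ} {s : Set ℂ} (hs : Convex ℝ s)
    (hf : ∀ z ∈ s, HasDerivAt f (f' z) z) {a : ℂ} (ha : ‖a‖ = 1) {c : ℝ} (hc0 : 0 < c)
    (hc : ∀ z ∈ s, c ≤ (a * f' z).re) (M : ℝ) : Bornology.IsBounded {z ∈ s | ‖f z‖ ≤ M} := by
  refine Metric.isBounded_iff.2 ⟨2 * M / c, fun z hz w hw => ?_⟩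
  have h := mul_norm_sub_le_of_le_re_mul hs hf ha hc hw.1 hz.1
  have h1 := norm_sub_le (f z) (f w)
  rw [dist_eq_norm, le_div_iff₀ hc0]
  linarith [hz.2, hw.2]

/-! ### Lower bounds for the digamma series -/

theorem mem_slitPlane_of_im_pos {z : ℂ} (hz : 0 < z.im) : z ∈ Complex.slitPlane :=
  Or.inr hz.ne'

theorem summable_im_digammaSeries {z : ℂ} (hz : z ∈ Complex.slitPlane) :
    Summable fun n : ℕ => z.im / Complex.normSq (z + (n + 1)) := by
  have h := (Complex.hasSum_im (summable_digammaSeries hz).hasSum).summable.neg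
  refine h.congr fun n => ?_
  have : (((n : ℂ) + 1)⁻¹).im = 0 := by
    rw [show (n : ℂ) + 1 = ((n + 1 : ℝ) : ℂ) by push_cast; rfl, ← Complex.ofReal_inv,
      Complex.ofReal_im]
  rw [Complex.sub_im, this, Complex.inv_im]
  simp [neg_div]

theorem im_digammaSeries {z : ℂ} (hz : z ∈ Complex.slitPlane) :
    (digammaSeries z).im =
      z.im / Complex.normSq z + ∑' n : ℕ, z.im / Complex.normSq (z + (n + 1)) := by
  have h : ∀ n : ℕ, ((z + (n + 1))⁻¹ - ((n : ℂ) + 1)⁻¹).im =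
      -(z.im / Complex.normSq (z + (n + 1))) := fun n => by
    have : (((n : ℂ) + 1)⁻¹).im = 0 := by
      rw [show (n : ℂ) + 1 = ((n + 1 : ℝ) : ℂ) by push_cast; rfl, ← Complex.ofReal_inv,
        Complex.ofReal_im]
    rw [Complex.sub_im, this, Complex.inv_im]
    simp [neg_div]
  rw [digammaSeries, Complex.sub_im, Complex.im_tsum (summable_digammaSeries hz)]
  simp only [h, tsum_neg]
  simp [Complex.inv_im, neg_div]

theorem im_digammaSeries_pos {z : ℂ} (hz : 0 < z.im) : 0 < (digammaSeries z).im := by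
  rw [im_digammaSeries (mem_slitPlane_of_im_pos hz)]
  have h1 : 0 < Complex.normSq z :=
    Complex.normSq_pos.2 (Complex.slitPlane_ne_zero (mem_slitPlane_of_im_pos hz))
  have h2 : 0 ≤ ∑' n : ℕ, z.im / Complex.normSq (z + (n + 1)) :=
    tsum_nonneg fun n => div_nonneg hz.le (Complex.normSq_nonneg _)
  positivity

/-- With `y = z.im`, at least `y / 4` indices `n` satisfy `0 ≤ z.re + n + 1 ≤ y`, and each
contributes at least `1 / (2 * y)`. -/
theorem one_div_eight_le_im_digammaSeries {x : ℝ} (hx : 0 ≤ x) {z : ℂ} (hzx : z.re ≤ x)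
    (h4 : 4 ≤ z.im) (hxy : 2 * (x + 1) ≤ z.im) : 1 / 8 ≤ (digammaSeries z).im := by
  have hy : 0 < z.im := by linarith
  have hz := mem_slitPlane_of_im_pos hy
  set y := z.im with hydef
  set a := ⌈max (-z.re) 0⌉₊ with ha
  set m := ⌊y / 2⌋₊ with hm
  have ha1 : -z.re ≤ a := (le_max_left _ _).trans (Nat.le_ceil _)
  have ha2 : (a : ℝ) < max (-z.re) 0 + 1 := Nat.ceil_lt_add_one (le_max_right _ _)
  have ha3 : z.re + a ≤ x + 1 := by
    rcases le_total (-z.re) 0 with h | h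
    · have : a = 0 := by rw [ha, max_eq_right h, Nat.ceil_zero]
      rw [this]
      push_cast
      linarith
    · rw [max_eq_left h] at ha2
      linarith
  have hm1 : (m : ℝ) ≤ y / 2 := Nat.floor_le (by positivity)
  have hm2 : y / 2 < m + 1 := Nat.lt_floor_add_one _
  have hterm : ∀ n ∈ Finset.Ico a (a + m), 1 / (2 * y) ≤ y / Complex.normSq (z + (n + 1)) := by
    intro n hn
    rw [Finset.mem_Ico] at hn
    have hn1 : (a : ℝ) ≤ n := by exact_mod_cast hn.1
    have hn2 : (n : ℝ) + 1 ≤ a + m := by exact_mod_cast hn.2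
    have hsq : Complex.normSq (z + (n + 1)) = (z.re + n + 1) ^ 2 + y ^ 2 := by
      rw [Complex.normSq_apply]
      simp
      ring
    rw [hsq, div_le_div_iff₀ (by positivity) (by positivity)]
    nlinarith
  rw [im_digammaSeries hz]
  have h1 : ∑ n ∈ Finset.Ico a (a + m), y / Complex.normSq (z + (n + 1)) ≤
      ∑' n : ℕ, y / Complex.normSq (z + (n + 1)) :=
    (summable_im_digammaSeries hz).sum_le_tsum _
      fun n _ => div_nonneg hy.le (Complex.normSq_nonneg _)
  have h2 := Finset.card_nsmul_le_sum _ _ _ hterm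
  rw [Nat.card_Ico, Nat.add_sub_cancel_left, nsmul_eq_mul] at h2
  have h3 : 1 / 8 ≤ (m : ℝ) * (1 / (2 * y)) := by
    rw [mul_one_div, div_le_div_iff₀ (by norm_num) (by positivity)]
    linarith
  have h5 : 0 ≤ y / Complex.normSq z := div_nonneg hy.le (Complex.normSq_nonneg _)
  linarith

/-- All terms of the negated series have nonnegative real part. The first eleven contribute at least
`2`, which outweighs `1 / 12` from `z⁻¹` and `γ < 2 / 3`. -/
theorem one_le_re_digammaSeries {z : ℂ} (hz : 12 ≤ z.re) : 1 ≤ (digammaSeries z).re := by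
  have hs : z ∈ Complex.slitPlane := Or.inl (by linarith)
  have hinv : ∀ w : ℂ, ∀ r : ℝ, 0 < r → r ≤ w.re → (w⁻¹).re ≤ r⁻¹ := fun w r hr hw =>
    calc (w⁻¹).re ≤ ‖w⁻¹‖ := Complex.re_le_norm _
      _ = ‖w‖⁻¹ := norm_inv _
      _ ≤ r⁻¹ := inv_anti₀ hr (hw.trans (Complex.re_le_norm _))
  have hre : ∀ n : ℕ, (((n : ℂ) + 1)⁻¹).re = ((n : ℝ) + 1)⁻¹ := fun n => by
    rw [show (n : ℂ) + 1 = ((n + 1 : ℝ) : ℂ) by push_cast; rfl, ← Complex.ofReal_inv,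
      Complex.ofReal_re]
  have hsum := (Complex.hasSum_re (summable_digammaSeries hs).hasSum).neg
  have hle : ∑ n ∈ Finset.range 11, -((z + (n + 1))⁻¹ - ((n : ℂ) + 1)⁻¹).re ≤
      -(∑' n : ℕ, ((z + (n + 1))⁻¹ - ((n : ℂ) + 1)⁻¹)).re := by
    refine sum_le_hasSum _ (fun n _ => ?_) hsum
    have := hinv (z + (n + 1)) (n + 1) (by positivity) (by simp; linarith)
    rw [Complex.sub_re, hre]
    linarith
  have hge : ∑ n ∈ Finset.range 11, (((n : ℝ) + 1)⁻¹ - 12⁻¹) ≤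
      ∑ n ∈ Finset.range 11, -((z + (n + 1))⁻¹ - ((n : ℂ) + 1)⁻¹).re := by
    refine Finset.sum_le_sum fun n _ => ?_
    have := hinv (z + (n + 1)) 12 (by positivity)
      (by simp only [Complex.add_re, Complex.natCast_re, Complex.one_re]; linarith [n.cast_nonneg (α := ℝ)])
    rw [Complex.sub_re, hre]
    linarith
  have hnum : (2 : ℝ) ≤ ∑ n ∈ Finset.range 11, (((n : ℝ) + 1)⁻¹ - 12⁻¹) := by
    norm_num [Finset.sum_range_succ]
  have h1 := hinv z 12 (by norm_num) hz
  have h2 := Real.eulerMascheroniConstant_lt_two_thirds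
  rw [digammaSeries]
  simp only [Complex.sub_re, Complex.neg_re, Complex.ofReal_re] at *
  linarith

/-! ### Injectivity, and boundedness of sublevel sets -/

theorem convex_upperHalfPlaneSet : Convex ℝ upperHalfPlaneSet := convex_halfSpace_im_gt 0

theorem im_logGamma_lt {z : ℂ} (hz : 0 < z.im) {w : ℂ} (hw : w.im = z.im) (hre : z.re < w.re) :
    (logGamma z).im < (logGamma w).im := by
  have hne : z ≠ w := fun h => hre.ne (by rw [h])
  obtain ⟨ξ, hξ, h⟩ := exists_re_mul_slope_eq convex_upperHalfPlaneSet
    (fun z hz => hasDerivAt_logGamma (mem_slitPlane_of_im_pos hz)) hz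
    (show 0 < w.im by rw [hw]; exact hz) hne (-Complex.I)
  have h1 : w - z = ((w.re - z.re : ℝ) : ℂ) := by
    apply Complex.ext <;> simp [hw]
  have h2 := im_digammaSeries_pos hξ
  have h3 : 0 < ((logGamma w - logGamma z) / (w - z)).im := by
    simp at h
    simpa [h] using h2
  rw [h1, Complex.div_ofReal_im, lt_div_iff₀ (sub_pos.2 hre)] at h3
  simpa using h3

theorem injOn_logGamma : Set.InjOn logGamma upperHalfPlaneSet := by
  intro z hz w hw heq
  by_contra hne
  obtain ⟨ξ, hξ, h⟩ := exists_re_mul_slope_eq convex_upperHalfPlaneSet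
    (fun z hz => hasDerivAt_logGamma (mem_slitPlane_of_im_pos hz)) hz hw hne (-Complex.I)
  have h2 := im_digammaSeries_pos hξ
  simp [heq] at h
  exact h2.ne h

theorem add_nat_ne_zero_of_im_pos {z : ℂ} (hz : 0 < z.im) (j : ℕ) : z + j ≠ 0 :=
  add_nat_ne_zero (mem_slitPlane_of_im_pos hz) j

theorem im_logGamma_le_add_one {z : ℂ} (hz : 0 < z.im) (hre : z.re ≤ 0) :
    (logGamma z).im ≤ (logGamma (z + 1)).im - Real.pi / 2 := by
  rw [logGamma_add_one (add_nat_ne_zero_of_im_pos hz), Complex.add_im, Complex.log_im]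
  have : Real.pi / 2 ≤ z.arg := by
    by_contra! h
    rw [Complex.arg_lt_pi_div_two_iff] at h
    rcases h with h | h | h
    · linarith
    · linarith
    · simp [h] at hz
  linarith

/-- Far to the left in a horizontal strip `logGamma` is large: each unit step left of the imaginary
axis lowers its imaginary part by at least `π / 2`. The constant comes from the segment `re = 1`, to
which monotonicity in `re` reduces the base case. -/
theorem exists_im_logGamma_le (Y : ℝ) : ∃ C : ℝ, ∀ m : ℕ, ∀ z : ℂ, 0 < z.im → z.im ≤ Y →
    z.re ≤ 1 - m → (logGamma z).im ≤ C - m * (Real.pi / 2) := by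
  have hcont : ContinuousOn (fun y : ℝ => logGamma (1 + y * Complex.I)) (Set.Icc 0 Y) := by
    intro y _
    have h1 : (1 + y * Complex.I) ∈ Complex.slitPlane := Or.inl (by simp)
    have h2 : ContinuousAt (fun y : ℝ => 1 + y * Complex.I) y := by fun_prop
    exact ((hasDerivAt_logGamma h1).continuousAt.comp (f := fun y : ℝ => 1 + y * Complex.I)
      h2).continuousWithinAt
  obtain ⟨C, hC⟩ := isCompact_Icc.exists_bound_of_continuousOn hcont
  refine ⟨C, fun m => ?_⟩
  induction m with
  | zero =>
    intro z hz hY hre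
    have h1 := hC z.im ⟨hz.le, hY⟩
    have h2 : (logGamma z).im ≤ (logGamma (1 + z.im * Complex.I)).im := by
      rcases eq_or_lt_of_le hre with h | h
      · have : z = 1 + z.im * Complex.I := by apply Complex.ext <;> simp [h]
        rw [← this]
      · exact (im_logGamma_lt hz (by simp) (by simpa using h)).le
    have h3 := (Complex.im_le_norm (logGamma (1 + z.im * Complex.I))).trans h1
    push_cast
    linarith
  | succ m ih =>
    intro z hz hY hre
    push_cast at hre ⊢
    have h1 := im_logGamma_le_add_one hz (by linarith [m.cast_nonneg (α := ℝ)])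
    have h2 := ih (z + 1) (by simpa using hz) (by simpa using hY) (by simp; linarith)
    linarith

theorem isBounded_norm_logGamma_le (M : ℝ) :
    Bornology.IsBounded {z ∈ upperHalfPlaneSet | ‖logGamma z‖ ≤ M} := by
  have hf : ∀ z ∈ upperHalfPlaneSet, HasDerivAt logGamma (digammaSeries z) z :=
    fun z hz => hasDerivAt_logGamma (mem_slitPlane_of_im_pos hz)
  -- Three regions cover the half-plane: right, upper left, and a strip; `26 = 2 * (12 + 1)` is the
  -- height required by `one_div_eight_le_im_digammaSeries`.
  have hA := isBounded_norm_le_of_le_re_mul (s := {z | 12 ≤ z.re} ∩ upperHalfPlaneSet)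
    ((convex_halfSpace_re_ge 12).inter convex_upperHalfPlaneSet) (fun z hz => hf z hz.2)
    (a := 1) (by simp) one_pos (fun z hz => by simpa using one_le_re_digammaSeries hz.1) M
  have hB := isBounded_norm_le_of_le_re_mul
    (s := {z | z.re ≤ 12} ∩ {z : ℂ | 26 ≤ z.im})
    ((convex_halfSpace_re_le 12).inter (convex_halfSpace_im_ge 26))
    (fun z hz => hf z ((show (0 : ℝ) < 26 by norm_num).trans_le hz.2))
    (a := -Complex.I) (by simp) (c := 1 / 8) (by norm_num)
    (fun z hz => by
      have h : (26 : ℝ) ≤ z.im := hz.2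
      have := one_div_eight_le_im_digammaSeries (x := 12) (by norm_num) hz.1 (by linarith)
        (by linarith)
      simpa using this) M
  obtain ⟨C, hC⟩ := exists_im_logGamma_le 26
  obtain ⟨m, hm⟩ := exists_nat_gt ((C + M) / (Real.pi / 2))
  rw [div_lt_iff₀ (by positivity)] at hm
  have hR : Bornology.IsBounded (Set.Icc (1 - (m : ℝ)) 12 ×ℂ Set.Icc 0 26) :=
    (Metric.isBounded_Icc _ _).reProdIm (Metric.isBounded_Icc _ _)
  refine ((hA.union hB).union hR).subset fun z hz => ?_
  have hzi : 0 < z.im := hz.1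
  by_cases h1 : 12 ≤ z.re
  · exact Or.inl (Or.inl ⟨⟨h1, hz.1⟩, hz.2⟩)
  by_cases h2 : 26 ≤ z.im
  · exact Or.inl (Or.inr ⟨⟨(not_le.1 h1).le, h2⟩, hz.2⟩)
  refine Or.inr ⟨⟨?_, (not_le.1 h1).le⟩, ⟨hzi.le, (not_le.1 h2).le⟩⟩
  by_contra! h
  have h3 := hC m z hzi (not_le.1 h2).le h.le
  have h4 := (abs_le.1 (Complex.abs_im_le_norm (logGamma z))).1
  linarith [hz.2]

/-! ### Boundary values on the real line -/

/-- The `k`-th interval of the real line cut at the poles of `Γ`, numbered from the right. -/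
def gammaInterval (k : ℕ) : Set ℝ := {p | 0 < p + k ∧ ∀ j < k, p + j < 0}

theorem gammaInterval_zero : gammaInterval 0 = Set.Ioi 0 := by
  ext p
  simp [gammaInterval]

theorem gammaInterval_of_pos {k : ℕ} (hk : 1 ≤ k) :
    gammaInterval k = Set.Ioo (-(k : ℝ)) (1 - k) := by
  obtain ⟨k, rfl⟩ := Nat.exists_eq_add_of_le' hk
  ext p
  simp only [gammaInterval, Set.mem_ofPred_eq, Set.mem_Ioo]
  constructor
  · rintro ⟨h1, h2⟩
    have := h2 k (Nat.lt_succ_self k)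
    push_cast at *
    constructor <;> linarith
  · rintro ⟨h1, h2⟩
    refine ⟨by linarith, fun j hj => ?_⟩
    have : (j : ℝ) ≤ k := by exact_mod_cast Nat.lt_succ_iff.1 hj
    push_cast at *
    linarith

theorem exists_mem_gammaInterval {p : ℝ} (hp : ∀ j : ℕ, p + j ≠ 0) : ∃ k, p ∈ gammaInterval k := by
  refine ⟨⌈-p⌉₊, lt_of_le_of_ne (by linarith [Nat.le_ceil (-p)]) (hp _).symm, fun j hj => ?_⟩
  linarith [Nat.lt_ceil.1 hj]

theorem add_nat_ne_zero_of_mem_gammaInterval {k : ℕ} {p : ℝ} (hp : p ∈ gammaInterval k) (j : ℕ) :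
    p + j ≠ 0 := by
  rcases lt_or_ge j k with h | h
  · exact (hp.2 j h).ne
  · have : (k : ℝ) ≤ j := by exact_mod_cast h
    linarith [hp.1]

theorem im_logGamma_ofReal_of_pos {p : ℝ} (hp : 0 < p) : (logGamma p).im = 0 := by
  have hterm : ∀ n : ℕ, logGammaTerm p n =
      ((Real.log (1 + p / (n + 1)) - p / (n + 1) : ℝ) : ℂ) := fun n => by
    rw [logGammaTerm, Complex.ofReal_sub, Complex.ofReal_log (by positivity)]
    push_cast
    rfl
  rw [logGamma]
  simp only [hterm]
  rw [← Complex.ofReal_tsum, ← Complex.ofReal_log hp.le, ← Complex.ofReal_mul,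
    ← Complex.ofReal_neg, ← Complex.ofReal_sub, ← Complex.ofReal_sub, Complex.ofReal_im]

theorem ofReal_add_nat_ne_zero {k : ℕ} {p : ℝ} (hp : p ∈ gammaInterval k) (j : ℕ) :
    (p : ℂ) + j ≠ 0 := by
  exact_mod_cast add_nat_ne_zero_of_mem_gammaInterval hp j

theorem re_logGamma {z : ℂ} (hz : ∀ j : ℕ, z + j ≠ 0) :
    (logGamma z).re = Real.log ‖Complex.Gamma z‖ := by
  rw [← exp_logGamma hz, Complex.norm_exp, Real.log_exp]

/-- Shifting by `k` reaches the positive axis and crosses `k` negative numbers, whose principal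
logarithms have imaginary part `π`. -/
theorem logGamma_ofReal {k : ℕ} {p : ℝ} (hp : p ∈ gammaInterval k) :
    logGamma p = ⟨Real.log |Real.Gamma p|, -(k * Real.pi)⟩ := by
  have hne := ofReal_add_nat_ne_zero hp
  apply Complex.ext
  · rw [re_logGamma hne, Complex.Gamma_ofReal, Complex.norm_real, Real.norm_eq_abs]
  · have h1 := congrArg Complex.im (logGamma_add_nat hne k)
    have h2 : ((p : ℂ) + k) = ((p + k : ℝ) : ℂ) := by push_cast; rfl
    have h3 : ∀ j ∈ Finset.range k, (Complex.log ((p : ℂ) + j)).im = Real.pi := fun j hj => by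
      rw [Complex.log_im, show ((p : ℂ) + j) = ((p + j : ℝ) : ℂ) by push_cast; rfl,
        Complex.arg_ofReal_of_neg (hp.2 j (Finset.mem_range.1 hj))]
    rw [h2, im_logGamma_ofReal_of_pos hp.1, Complex.add_im, Complex.im_sum,
      Finset.sum_congr rfl h3] at h1
    simp at h1
    simp
    linarith

/-- After the shift by `k` only principal logarithms remain, and these are continuous from above at
negative reals. -/
theorem tendsto_logGamma_ofReal {k : ℕ} {p : ℝ} (hp : p ∈ gammaInterval k) :
    Tendsto logGamma (𝓝[upperHalfPlaneSet] (p : ℂ)) (𝓝 (logGamma p)) := by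
  have hne := ofReal_add_nat_ne_zero hp
  have h1 : Tendsto (fun z : ℂ => logGamma (z + k)) (𝓝[upperHalfPlaneSet] (p : ℂ))
      (𝓝 (logGamma (p + k))) := by
    have hs : (p : ℂ) + k ∈ Complex.slitPlane := Or.inl (by simpa using hp.1)
    have hc : ContinuousAt (fun z : ℂ => z + k) (p : ℂ) := by fun_prop
    exact ((hasDerivAt_logGamma hs).continuousAt.comp (f := fun z : ℂ => z + k)
      hc).tendsto.mono_left nhdsWithin_le_nhds
  have h2 : ∀ j ∈ Finset.range k, Tendsto (fun z : ℂ => Complex.log (z + j))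
      (𝓝[upperHalfPlaneSet] (p : ℂ)) (𝓝 (Complex.log (p + j))) := fun j hj => by
    have hlog := Complex.continuousWithinAt_log_of_re_neg_of_im_zero (z := (p : ℂ) + j)
      (by simpa using hp.2 j (Finset.mem_range.1 hj)) (by simp)
    have hc : ContinuousWithinAt (fun z : ℂ => z + j) upperHalfPlaneSet (p : ℂ) := by fun_prop
    exact hlog.comp (f := fun z : ℂ => z + j) hc fun z hz => by
      simpa using (show 0 < z.im from hz).le
  have h3 := h1.sub (tendsto_finsetSum _ h2)
  rw [logGamma_add_nat hne, add_sub_cancel_right] at h3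
  refine h3.congr' ?_
  filter_upwards [self_mem_nhdsWithin] with z hz
  rw [logGamma_add_nat (add_nat_ne_zero_of_im_pos hz), add_sub_cancel_right]

/-! ### Minimum points of |Γ| -/

theorem Gamma_ne_zero_of_mem_gammaInterval {k : ℕ} {p : ℝ} (hp : p ∈ gammaInterval k) :
    Real.Gamma p ≠ 0 :=
  Real.Gamma_ne_zero fun m h => add_nat_ne_zero_of_mem_gammaInterval hp m (by rw [h]; ring)

theorem convex_gammaInterval (k : ℕ) : Convex ℝ (gammaInterval k) := by
  rcases Nat.eq_zero_or_pos k with rfl | hk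
  · rw [gammaInterval_zero]
    exact convex_Ioi 0
  · rw [gammaInterval_of_pos hk]
    exact convex_Ioo _ _

theorem log_abs_Gamma_eq {k : ℕ} {p : ℝ} (hp : p ∈ gammaInterval k) :
    Real.log |Real.Gamma p| = Real.log (Real.Gamma (p + (k + 1)))
      + ∑ j ∈ Finset.range k, -Real.log (p + j) + -Real.log (p + k) := by
  have hne := ofReal_add_nat_ne_zero hp
  have h := congrArg Complex.re (logGamma_add_nat hne (k + 1))
  have hne' : ∀ j : ℕ, (p : ℂ) + ((k + 1 : ℕ) : ℂ) + j ≠ 0 := fun j => by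
    simpa [add_assoc] using hne (k + 1 + j)
  have hlog : ∀ j : ℕ, (Complex.log ((p : ℂ) + j)).re = Real.log (p + j) := fun j => by
    rw [Complex.log_re, show ((p : ℂ) + j) = ((p + j : ℝ) : ℂ) by push_cast; rfl,
      Complex.norm_real, Real.norm_eq_abs, Real.log_abs]
  rw [Complex.add_re, Complex.re_sum, re_logGamma hne', re_logGamma hne, Finset.sum_range_succ,
    show (p : ℂ) + ((k + 1 : ℕ) : ℂ) = ((p + (k + 1) : ℝ) : ℂ) by push_cast; rfl,
    Complex.Gamma_ofReal, Complex.Gamma_ofReal, Complex.norm_real, Complex.norm_real,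
    Real.norm_eq_abs, Real.norm_eq_abs, Real.log_abs (Real.Gamma (p + _))] at h
  simp only [hlog] at h
  rw [Finset.sum_neg_distrib]
  linarith

/-- The shift is by `k + 1` rather than `k`: log-convexity of `Γ` is not strict as used, so the
extra term `-log (p + k)` supplies strictness. `Real.log` is `log |·|` on negative numbers. -/
theorem strictConvexOn_log_abs_Gamma (k : ℕ) :
    StrictConvexOn ℝ (gammaInterval k) fun p => Real.log |Real.Gamma p| := by
  have h1 : ConvexOn ℝ (gammaInterval k) fun p => Real.log (Real.Gamma (p + (k + 1))) :=
    (Real.convexOn_log_Gamma.translate_left ((k : ℝ) + 1)).subset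
      (fun p hp => show 0 < (k : ℝ) + 1 + p by linarith [hp.1]) (convex_gammaInterval k)
  have h2 : ∀ m ≤ k, ConvexOn ℝ (gammaInterval k)
      fun p => ∑ j ∈ Finset.range m, -Real.log (p + j) := by
    intro m hm
    induction m with
    | zero => simpa using convexOn_const 0 (convex_gammaInterval k)
    | succ m ih =>
      simp only [Finset.sum_range_succ]
      refine (ih (by omega)).add ?_
      exact (strictConcaveOn_log_Iio.neg.convexOn.translate_left (m : ℝ)).subset
        (fun p hp => show (m : ℝ) + p < 0 by linarith [hp.2 m (by omega)]) (convex_gammaInterval k)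
  have h3 : StrictConvexOn ℝ (gammaInterval k) fun p => -Real.log (p + k) :=
    (strictConcaveOn_log_Ioi.neg.translate_left (k : ℝ)).subset
      (fun p hp => show 0 < (k : ℝ) + p by linarith [hp.1]) (convex_gammaInterval k)
  exact ((h1.add (h2 k le_rfl)).add_strictConvexOn h3).congr fun p hp => (log_abs_Gamma_eq hp).symm

/-- Continuity holds through the poles, where the conventions `Γ = 0` and `0⁻¹ = 0` agree with the
entire function `1 / Γ`. Minima of `|Γ|` thus become maxima on compact intervals. -/
theorem continuous_inv_abs_Gamma : Continuous fun p : ℝ => |Real.Gamma p|⁻¹ := by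
  have h := (Complex.differentiable_one_div_Gamma.continuous.comp Complex.continuous_ofReal).norm
  refine h.congr fun p => ?_
  simp [Complex.Gamma_ofReal]

theorem exists_isMinOn_abs_Gamma (k : ℕ) :
    ∃ p ∈ gammaInterval k, IsMinOn (fun t => |Real.Gamma t|) (gammaInterval k) p := by
  have hmax : ∀ a b : ℝ, a < b → ∃ q ∈ Set.Icc a b, ∀ p ∈ Set.Icc a b,
      |Real.Gamma p|⁻¹ ≤ |Real.Gamma q|⁻¹ := fun a b hab =>
    isCompact_Icc.exists_isMaxOn (Set.nonempty_Icc.2 hab.le) continuous_inv_abs_Gamma.continuousOn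
  have hinv : ∀ q p : ℝ, Real.Gamma p ≠ 0 → |Real.Gamma p|⁻¹ ≤ |Real.Gamma q|⁻¹ →
      Real.Gamma q ≠ 0 ∧ |Real.Gamma q| ≤ |Real.Gamma p| := fun q p hp h => by
    have hp' := abs_pos.2 hp
    have hq' : 0 < |Real.Gamma q| := inv_pos.1 ((inv_pos.2 hp').trans_le h)
    exact ⟨abs_pos.1 hq', (inv_le_inv₀ hp' hq').1 h⟩
  rcases Nat.eq_zero_or_pos k with rfl | hk
  · obtain ⟨q, hq, h⟩ := hmax 0 2 two_pos
    rw [gammaInterval_zero]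
    have h1 := hinv q 1 (by simp) (h 1 (by norm_num))
    have hq0 : q ≠ 0 := fun h0 => h1.1 (by rw [h0, Real.Gamma_zero])
    refine ⟨q, lt_of_le_of_ne hq.1 hq0.symm, fun p hp => ?_⟩
    have hp' : 0 < p := hp
    rcases le_total p 2 with h2 | h2
    · exact (hinv q p (Real.Gamma_pos_of_pos hp').ne' (h p ⟨hp'.le, h2⟩)).2
    · have h3 := (hinv q 2 (by simp) (h 2 (by norm_num))).2
      have h4 := Real.Gamma_strictMonoOn_Ici.monotoneOn (Set.self_mem_Ici) h2 h2
      refine h3.trans ?_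
      simp only [abs_of_pos (Real.Gamma_pos_of_pos two_pos), abs_of_pos (Real.Gamma_pos_of_pos hp')]
      exact h4
  · have hsub : gammaInterval k = Set.Ioo (-(k : ℝ)) (1 - k) := gammaInterval_of_pos hk
    obtain ⟨q, hq, h⟩ := hmax (-k) (1 - k) (by linarith)
    have hmem : -(k : ℝ) + 1 / 2 ∈ gammaInterval k := by
      rw [hsub]
      constructor <;> linarith
    have h1 := hinv q _ (Gamma_ne_zero_of_mem_gammaInterval hmem)
      (h _ (Set.Ioo_subset_Icc_self (hsub ▸ hmem)))
    have hqa : q ≠ -k := fun h0 => h1.1 (by rw [h0, Real.Gamma_neg_nat_eq_zero])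
    have hqb : q ≠ 1 - k := fun h0 => h1.1 (by
      rw [h0, show (1 : ℝ) - k = -((k - 1 : ℕ) : ℝ) by push_cast [Nat.cast_sub hk]; ring,
        Real.Gamma_neg_nat_eq_zero])
    refine ⟨q, ?_, fun p hp => ?_⟩
    · rw [hsub]
      exact ⟨lt_of_le_of_ne hq.1 hqa.symm, lt_of_le_of_ne hq.2 hqb⟩
    · exact (hinv q p (Gamma_ne_zero_of_mem_gammaInterval hp)
        (h p (Set.Ioo_subset_Icc_self (hsub ▸ hp)))).2

theorem isGammaMinPoints_iff {x : ℕ → ℝ} : IsGammaMinPoints x ↔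
    ∀ k, x k ∈ gammaInterval k ∧ IsMinOn (fun t => |Real.Gamma t|) (gammaInterval k) (x k) := by
  have h0 : (x 0 ∈ Set.Ioi (0 : ℝ) ∧ IsMinOn Real.Gamma (Set.Ioi 0) (x 0)) ↔
      x 0 ∈ gammaInterval 0 ∧ IsMinOn (fun t => |Real.Gamma t|) (gammaInterval 0) (x 0) := by
    rw [gammaInterval_zero]
    refine and_congr_right fun hx => ?_
    rw [isMinOn_iff, isMinOn_iff]
    refine forall₂_congr fun p hp => ?_
    rw [abs_of_pos (Real.Gamma_pos_of_pos hx), abs_of_pos (Real.Gamma_pos_of_pos hp)]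
  rw [IsGammaMinPoints, h0]
  constructor
  · rintro ⟨h1, h2⟩ k
    rcases Nat.eq_zero_or_pos k with rfl | hk
    · exact h1
    · rw [gammaInterval_of_pos hk]
      exact h2 k hk
  · refine fun h => ⟨h 0, fun k hk => ?_⟩
    rw [← gammaInterval_of_pos hk]
    exact h k

theorem existsUnique_isGammaMinPoints : ∃! x : ℕ → ℝ, IsGammaMinPoints x := by
  choose x hx hmin using exists_isMinOn_abs_Gamma
  refine ⟨x, isGammaMinPoints_iff.2 fun k => ⟨hx k, hmin k⟩, fun y hy => funext fun k => ?_⟩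
  have hlog : ∀ q ∈ gammaInterval k, IsMinOn (fun t => |Real.Gamma t|) (gammaInterval k) q →
      IsMinOn (fun t => Real.log |Real.Gamma t|) (gammaInterval k) q := fun q hq h p hp =>
    Real.log_le_log (abs_pos.2 (Gamma_ne_zero_of_mem_gammaInterval hq)) (h hp)
  obtain ⟨hy1, hy2⟩ := isGammaMinPoints_iff.1 hy k
  exact (strictConvexOn_log_abs_Gamma k).eq_of_isMinOn (hlog _ hy1 hy2) (hlog _ (hx k) (hmin k))
    hy1 (hx k)

theorem exists_log_abs_Gamma_eq {k : ℕ} {q t : ℝ} (hq : q ∈ gammaInterval k)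
    (ht : Real.log |Real.Gamma q| ≤ t) : ∃ p ∈ gammaInterval k, Real.log |Real.Gamma p| = t := by
  have hqpos := abs_pos.2 (Gamma_ne_zero_of_mem_gammaInterval hq)
  have hkq : -(k : ℝ) ≤ q := by linarith [hq.1]
  -- The left endpoint `-k` is a pole for every `k`, including `0`, so `1 / |Γ|` rises from `0`
  -- there.
  have h1 : Real.exp (-t) ∈ Set.Icc |Real.Gamma (-k)|⁻¹ |Real.Gamma q|⁻¹ := by
    rw [Real.Gamma_neg_nat_eq_zero, abs_zero, inv_zero, Real.exp_neg]
    refine ⟨by positivity, inv_anti₀ hqpos ?_⟩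
    rwa [← Real.log_le_iff_le_exp hqpos]
  obtain ⟨p, hp, h⟩ := intermediate_value_Icc hkq continuous_inv_abs_Gamma.continuousOn h1
  have hne : p ≠ -k := by
    rintro rfl
    simp only [Real.Gamma_neg_nat_eq_zero, abs_zero, inv_zero] at h
    exact (Real.exp_pos _).ne h
  refine ⟨p, ⟨?_, fun j hj => ?_⟩, ?_⟩
  · linarith [lt_of_le_of_ne hp.1 hne.symm]
  · linarith [hp.2, hq.2 j hj]
  · simp only at h
    rw [← inv_inv |Real.Gamma p|, h, ← Real.exp_neg, Real.log_exp, neg_neg]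

/-! ### Connectedness of the slit domain -/

theorem mem_slitDomain_iff {x : ℕ → ℝ} {w : ℂ} :
    w ∈ slitDomain x ↔ ∀ k : ℕ, w.im = -(k * Real.pi) → w.re < Real.log |Real.Gamma (x k)| := by
  simp only [slitDomain, Set.mem_compl_iff, Set.mem_iUnion, not_exists, Complex.mem_reProdIm,
    Set.mem_Ici, Set.mem_singleton_iff, not_and']
  simp

theorem isPreconnected_slitDomain (x : ℕ → ℝ) : IsPreconnected (slitDomain x) := by
  refine isPreconnected_of_forall Complex.I fun w hw => ?_
  rw [mem_slitDomain_iff] at hw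
  obtain ⟨K, hK⟩ := exists_nat_gt (-w.im / Real.pi)
  rw [div_lt_iff₀ Real.pi_pos] at hK
  obtain ⟨b, hb⟩ : ∃ b, ∀ k < K, b < Real.log |Real.Gamma (x k)| := by
    obtain ⟨b, hb⟩ := ((Finset.range K).image fun k => Real.log |Real.Gamma (x k)|).bddBelow
    refine ⟨b - 1, fun k hk => ?_⟩
    have := hb (Finset.mem_coe.2 (Finset.mem_image_of_mem _ (Finset.mem_range.2 hk)))
    linarith
  -- Only slits with `k < K` lie at or above the height of `w`. The path runs left to `re = a`,
  -- before all of them, then up into the half-plane.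
  set a := min b w.re with ha
  set H : Set ℂ := {z | z.re ≤ w.re} ∩ {z | z.im = w.im} with hH
  set L : Set ℂ := {z | z.re = a} ∩ {z | w.im ≤ z.im} with hL
  have hHc : IsPreconnected H :=
    ((convex_halfSpace_re_le _).inter (convex_hyperplane Complex.imLm.isLinear _)).isPreconnected
  have hLc : IsPreconnected L :=
    ((convex_hyperplane Complex.reLm.isLinear _).inter (convex_halfSpace_im_ge _)).isPreconnected
  have h1 : IsPreconnected (H ∪ L) := hHc.union ⟨a, w.im⟩
    ⟨show a ≤ w.re from min_le_right _ _, rfl⟩ ⟨rfl, le_refl w.im⟩ hLc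
  have h2 : IsPreconnected (H ∪ L ∪ upperHalfPlaneSet) :=
    h1.union ⟨a, max w.im 1⟩ (Or.inr ⟨rfl, show w.im ≤ max w.im 1 from le_max_left _ _⟩)
      (show 0 < max w.im 1 from lt_max_of_lt_right one_pos)
      convex_upperHalfPlaneSet.isPreconnected
  refine ⟨_, ?_, Or.inr ?_, Or.inl (Or.inl ⟨le_refl w.re, rfl⟩), h2⟩
  · rintro z ((⟨hz1, hz2⟩ | ⟨hz1, hz2⟩) | hz) <;> rw [mem_slitDomain_iff] <;> intro k hk
    · exact lt_of_le_of_lt hz1 (hw k ((show z.im = w.im from hz2) ▸ hk))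
    · have hz1' : z.re = a := hz1
      have hz2' : w.im ≤ z.im := hz2
      have hkK : (k : ℝ) < K := by
        have : (k : ℝ) * Real.pi < K * Real.pi := by linarith
        exact lt_of_mul_lt_mul_right this Real.pi_pos.le
      rw [hz1']
      exact lt_of_le_of_lt (min_le_left _ _) (hb k (by exact_mod_cast hkK))
    · have hz' : 0 < z.im := hz
      have : 0 ≤ (k : ℝ) * Real.pi := by positivity
      linarith
  · show 0 < Complex.I.im
    simp

/-! ### The open image and the holomorphic inverse -/

theorem map_nhds_logGamma {z : ℂ} (hz : z ∈ upperHalfPlaneSet) :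
    map logGamma (𝓝 z) = 𝓝 (logGamma z) := by
  have hd : DifferentiableOn ℂ logGamma upperHalfPlaneSet := fun z hz =>
    (hasDerivAt_logGamma (mem_slitPlane_of_im_pos hz)).differentiableAt.differentiableWithinAt
  have hs := (hd.analyticAt (UpperHalfPlane.isOpen_upperHalfPlaneSet.mem_nhds hz)).hasStrictDerivAt
  rw [(hasDerivAt_logGamma (mem_slitPlane_of_im_pos hz)).deriv] at hs
  exact hs.map_nhds_eq fun h => (im_digammaSeries_pos hz).ne' (by rw [h, Complex.zero_im])

theorem isOpen_image_logGamma : IsOpen (logGamma '' upperHalfPlaneSet) := by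
  rw [isOpen_iff_mem_nhds]
  rintro _ ⟨z, hz, rfl⟩
  rw [← map_nhds_logGamma hz]
  exact image_mem_map (UpperHalfPlane.isOpen_upperHalfPlaneSet.mem_nhds hz)

theorem tendsto_invFunOn_logGamma {z : ℂ} (hz : z ∈ upperHalfPlaneSet) :
    Tendsto (Function.invFunOn logGamma upperHalfPlaneSet) (𝓝 (logGamma z)) (𝓝 z) := by
  rw [← map_nhds_logGamma hz, tendsto_map'_iff]
  refine tendsto_id.congr' ?_
  filter_upwards [UpperHalfPlane.isOpen_upperHalfPlaneSet.mem_nhds hz] with y hy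
  exact (injOn_logGamma.leftInvOn_invFunOn hy).symm

theorem hasDerivAt_invFunOn_logGamma {z : ℂ} (hz : z ∈ upperHalfPlaneSet) :
    HasDerivAt (Function.invFunOn logGamma upperHalfPlaneSet) (digammaSeries z)⁻¹ (logGamma z) := by
  have hinv := injOn_logGamma.leftInvOn_invFunOn hz
  refine HasDerivAt.of_local_left_inverse (f := logGamma) ?_ ?_
    (fun h => (im_digammaSeries_pos hz).ne' (by rw [h, Complex.zero_im])) ?_
  · rw [ContinuousAt, hinv]
    exact tendsto_invFunOn_logGamma hz
  · rw [hinv]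
    exact hasDerivAt_logGamma (mem_slitPlane_of_im_pos hz)
  · filter_upwards [isOpen_image_logGamma.mem_nhds ⟨z, hz, rfl⟩] with w hw
    exact Function.invFunOn_eq hw

theorem ofReal_mem_closure_upperHalfPlaneSet (p : ℝ) : (p : ℂ) ∈ closure upperHalfPlaneSet := by
  show (p : ℂ) ∈ closure {z : ℂ | 0 < z.im}
  rw [Complex.closure_setOfPred_lt_im]
  simp

/-! ### Identification of the image -/

theorem logGamma_ofReal_notMem_image {k : ℕ} {p : ℝ} (hp : p ∈ gammaInterval k) :
    logGamma p ∉ logGamma '' upperHalfPlaneSet := by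
  rintro ⟨z, hz, h⟩
  have : (𝓝[upperHalfPlaneSet] (p : ℂ)).NeBot :=
    mem_closure_iff_nhdsWithin_neBot.1 (ofReal_mem_closure_upperHalfPlaneSet p)
  have h1 : Tendsto id (𝓝[upperHalfPlaneSet] (p : ℂ)) (𝓝 z) := by
    refine ((tendsto_invFunOn_logGamma hz).comp (h ▸ tendsto_logGamma_ofReal hp)).congr' ?_
    filter_upwards [self_mem_nhdsWithin] with y hy
    exact injOn_logGamma.leftInvOn_invFunOn hy
  have h2 : z = p := tendsto_nhds_unique h1 (tendsto_id.mono_left nhdsWithin_le_nhds)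
  rw [h2] at hz
  exact lt_irrefl (0 : ℝ) (by simpa using (show 0 < (p : ℂ).im from hz))

theorem image_logGamma_subset {x : ℕ → ℝ} (hx : IsGammaMinPoints x) :
    logGamma '' upperHalfPlaneSet ⊆ slitDomain x := by
  intro w hw
  rw [mem_slitDomain_iff]
  intro k hk
  by_contra! h
  obtain ⟨p, hp, hpt⟩ := exists_log_abs_Gamma_eq (isGammaMinPoints_iff.1 hx k).1 h
  refine logGamma_ofReal_notMem_image hp ?_
  rw [logGamma_ofReal hp, hpt, ← hk]
  exact hw

theorem closure_image_logGamma_inter_subset {x : ℕ → ℝ} (hx : IsGammaMinPoints x) :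
    closure (logGamma '' upperHalfPlaneSet) ∩ slitDomain x ⊆ logGamma '' upperHalfPlaneSet := by
  rintro w ⟨hw, hwx⟩
  obtain ⟨u, hu, hlim⟩ := mem_closure_iff_seq_limit.1 hw
  choose z hz hzu using hu
  obtain ⟨M, hM⟩ := (Metric.isBounded_range_of_tendsto u hlim).exists_norm_le
  obtain ⟨z₀, -, φ, hφ, hz₀⟩ := tendsto_subseq_of_bounded (isBounded_norm_logGamma_le M)
    fun n => ⟨hz n, (hzu n).symm ▸ hM _ ⟨n, rfl⟩⟩
  have hlim' : Tendsto (fun n => logGamma (z (φ n))) atTop (𝓝 w) := by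
    simpa only [hzu, Function.comp_def] using hlim.comp hφ.tendsto_atTop
  have him : 0 ≤ z₀.im := ge_of_tendsto' ((Complex.continuous_im.tendsto z₀).comp hz₀)
    fun n => (show 0 < (z (φ n)).im from hz (φ n)).le
  rcases him.lt_or_eq with hpos | hzero
  · exact ⟨z₀, hpos, tendsto_nhds_unique
      ((hasDerivAt_logGamma (mem_slitPlane_of_im_pos hpos)).continuousAt.tendsto.comp hz₀) hlim'⟩
  exfalso
  have hreal : z₀ = (z₀.re : ℂ) := Complex.ext (by simp) (by simp [← hzero])
  by_cases hpole : ∀ j : ℕ, z₀.re + j ≠ 0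
  · obtain ⟨k, hk⟩ := exists_mem_gammaInterval hpole
    have hwithin : Tendsto (fun n => z (φ n)) atTop (𝓝[upperHalfPlaneSet] (z₀.re : ℂ)) :=
      tendsto_nhdsWithin_iff.2 ⟨hreal ▸ hz₀, Eventually.of_forall fun n => hz (φ n)⟩
    have heq := tendsto_nhds_unique ((tendsto_logGamma_ofReal hk).comp hwithin) hlim'
    rw [logGamma_ofReal hk] at heq
    have h1 := mem_slitDomain_iff.1 hwx k (by rw [← heq])
    obtain ⟨h2, h3⟩ := isGammaMinPoints_iff.1 hx k
    rw [← heq] at h1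
    exact h1.not_ge (Real.log_le_log (abs_pos.2 (Gamma_ne_zero_of_mem_gammaInterval h2)) (h3 hk))
  · push Not at hpole
    obtain ⟨j, hj⟩ := hpole
    -- At a pole, `exp (-logGamma)` tends to `1 / Γ = 0`, yet its limit `exp (-w)` is nonzero.
    have h0 : (Complex.Gamma z₀)⁻¹ = 0 := by
      rw [hreal, show z₀.re = -(j : ℝ) by linarith]
      push_cast
      rw [Complex.Gamma_neg_nat_eq_zero, inv_zero]
    have h1 := (Complex.differentiable_one_div_Gamma.continuous.tendsto z₀).comp hz₀
    have h2 : Tendsto (fun n => Complex.exp (-logGamma (z (φ n)))) atTop (𝓝 (Complex.exp (-w))) :=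
      (Complex.continuous_exp.tendsto _).comp hlim'.neg
    rw [h0] at h1
    refine Complex.exp_ne_zero (-w) (tendsto_nhds_unique h2 (h1.congr fun n => ?_))
    simp [Complex.exp_neg, exp_logGamma (add_nat_ne_zero_of_im_pos (hz (φ n)))]

theorem image_logGamma {x : ℕ → ℝ} (hx : IsGammaMinPoints x) :
    logGamma '' upperHalfPlaneSet = slitDomain x := by
  have hsub := image_logGamma_subset hx
  have hI : logGamma Complex.I ∈ logGamma '' upperHalfPlaneSet :=
    Set.mem_image_of_mem _ (show 0 < Complex.I.im by simp)
  exact hsub.antisymm ((isPreconnected_slitDomain x).subset_of_closure_inter_subset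
    isOpen_image_logGamma ⟨_, hsub hI, hI⟩ (closure_image_logGamma_inter_subset hx))

/-! ### The inverse branches of Γ -/

theorem mapsTo_shiftedLog (x : ℕ → ℝ) (k : ℤ) :
    Set.MapsTo (shiftedLog k) upperHalfPlaneSet (slitDomain x) := by
  intro z hz
  have hz' : 0 < z.im := hz
  rw [mem_slitDomain_iff]
  intro j hj
  exfalso
  have him : (shiftedLog k z).im = z.arg - (k + 1) * Real.pi := by
    simp [shiftedLog, Complex.log_im]
  have h1 : 0 < z.arg := (Complex.arg_nonneg_iff.2 hz'.le).lt_of_ne fun h => by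
    have := Complex.arg_eq_zero_iff.1 h.symm
    linarith [this.2]
  have h2 : z.arg < Real.pi := Complex.arg_lt_pi_iff.2 (Or.inr hz'.ne')
  rw [him] at hj
  have h3 : z.arg = ((k + 1 - j : ℤ) : ℝ) * Real.pi := by
    push_cast
    linarith
  rw [h3] at h1 h2
  have h4 : (0 : ℝ) < ((k + 1 - j : ℤ) : ℝ) := pos_of_mul_pos_left h1 Real.pi_pos.le
  have h5 : ((k + 1 - j : ℤ) : ℝ) < 1 :=
    lt_of_mul_lt_mul_right (by linarith) Real.pi_pos.le
  have h6 : 0 < k + 1 - (j : ℤ) := by exact_mod_cast h4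
  have h7 : k + 1 - (j : ℤ) < 1 := by exact_mod_cast h5
  omega

theorem exp_shiftedLog (k : ℤ) {z : ℂ} (hz : z ≠ 0) :
    Complex.exp (shiftedLog k z) = (-1) ^ (k + 1) * z := by
  have h : Complex.exp (-(Complex.I * ((k : ℂ) + 1) * Real.pi)) = (-1) ^ (k + 1) := by
    have : -(Complex.I * ((k : ℂ) + 1) * Real.pi) = ((k + 1 : ℤ) : ℂ) * (-(Real.pi * Complex.I)) := by
      push_cast
      ring
    rw [this, Complex.exp_int_mul, Complex.exp_neg, Complex.exp_pi_mul_I]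
    norm_num
  rw [shiftedLog, sub_eq_add_neg, Complex.exp_add, Complex.exp_log hz, h, mul_comm]

theorem mainTheorem5 :
    (∀ z ∈ Complex.slitPlane, Summable (logGammaTerm z)) ∧
    (∃! x : ℕ → ℝ, IsGammaMinPoints x) ∧
    (∀ x : ℕ → ℝ, IsGammaMinPoints x →
      IsConformalMapping logGamma UpperHalfPlane.upperHalfPlaneSet ∧
      logGamma '' UpperHalfPlane.upperHalfPlaneSet = slitDomain x ∧
      ∀ k : ℤ, Set.MapsTo (shiftedLog k) UpperHalfPlane.upperHalfPlaneSet (slitDomain x)) ∧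
    (∀ k : ℤ,
      IsNevanlinnaPick (gammaInverse k) ∧
      Set.MapsTo (gammaInverse k) UpperHalfPlane.upperHalfPlaneSet
        UpperHalfPlane.upperHalfPlaneSet ∧
      ∀ z ∈ UpperHalfPlane.upperHalfPlaneSet,
        Complex.Gamma (gammaInverse k z) = (-1 : ℂ) ^ (k + 1) * z) := by
  have hd : ∀ z ∈ upperHalfPlaneSet, HasDerivAt logGamma (digammaSeries z) z :=
    fun z hz => hasDerivAt_logGamma (mem_slitPlane_of_im_pos hz)
  refine ⟨fun z _ => summable_logGammaTerm z, existsUnique_isGammaMinPoints,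
    fun x hx => ⟨⟨fun z hz => (hd z hz).differentiableAt.differentiableWithinAt, injOn_logGamma,
      fun z hz h => ?_⟩, image_logGamma hx, mapsTo_shiftedLog x⟩, fun k => ?_⟩
  · rw [(hd z hz).deriv] at h
    exact (im_digammaSeries_pos hz).ne' (by rw [h, Complex.zero_im])
  · obtain ⟨x, hx, -⟩ := existsUnique_isGammaMinPoints
    have hmem : ∀ z ∈ upperHalfPlaneSet, shiftedLog k z ∈ logGamma '' upperHalfPlaneSet :=
      fun z hz => image_logGamma hx ▸ mapsTo_shiftedLog x k hz
    have hmaps : Set.MapsTo (gammaInverse k) upperHalfPlaneSet upperHalfPlaneSet :=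
      fun z hz => Function.invFunOn_mem (hmem z hz)
    have hright : ∀ z ∈ upperHalfPlaneSet, logGamma (gammaInverse k z) = shiftedLog k z :=
      fun z hz => Function.invFunOn_eq (hmem z hz)
    refine ⟨⟨fun z hz => ?_, fun z hz => subset_closure (hmaps hz)⟩, hmaps, fun z hz => ?_⟩
    · have h1 := hasDerivAt_invFunOn_logGamma (hmaps hz)
      rw [hright z hz] at h1
      have h2 : DifferentiableAt ℂ (shiftedLog k) z :=
        (Complex.differentiableAt_log (mem_slitPlane_of_im_pos hz)).sub_const _
      exact (h1.differentiableAt.comp z h2).differentiableWithinAt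
    · rw [← exp_logGamma (add_nat_ne_zero_of_im_pos (hmaps hz)), hright z hz]
      exact exp_shiftedLog k (Complex.slitPlane_ne_zero (mem_slitPlane_of_im_pos hz))
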